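/- Let $\diamondsuit^+$ be the assertion that there are countable families $W_\alpha$ ($\alpha<\omega_1$) of subsets of $\omega_1$ such that for every $X\subseteq\omega_1$ there is a closed unbounded $D\subseteq\omega_1$ with $X\cap\alpha\in W_\alpha$ and $D\cap\alpha\in W_\alpha$ for all $\alpha\in D$. A ladder system $\mathbf C=(C_\alpha)_{\alpha\in\lim\omega_1}$ assigns to each countable limit ordinal $\alpha>0$ a cofinal subset $C_\alpha\subseteq\alpha$ of order type $\omega$. For $n\in\{2,\omega\}$, an $n$-colouring of $\mathbf C$ is a sequence $\mathbf f=(f_\alpha)_{\alpha\in\lim\omega_1}$ of maps $f_\alpha:C_\alpha\to n$; it is monochromatic if every $f_\alpha$ is constant. A tree is a partial order $T$ in which $\{s: s<t\}$ is well ordered for every $t\in T$; the height of $t$ is the order type of this set, the $\alpha$th level of $T$ is the set of its nodes of height $\alpha$, the height of $T$ is the least $\alpha$ whose level is empty, and for $\xi$ below the height of $t$, $t\restriction\xi$ is the unique predecessor of $t$ of height $\xi$. An Aronszajn tree is a tree of height $\omega_1$ with countable levels and no uncountable chains. A subtree of a tree $T$ of height $\omega_1$ is a nonempty downward closed set $S\subseteq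 T$ such that for every $s\in S$ and $\alpha<\omega_1$ there is $t\in S$ with $s\le t$ of height at least $\alpha$. A $T$-uniformization of an $n$-colouring $\mathbf f$ is a map $\varphi:S\to n$ on a subtree $S$ of $T$ such that for every $s\in S$ of limit height $\alpha<\omega_1$, $\varphi(s\restriction\xi)=f_\alpha(\xi)$ for all but finitely many $\xi\in C_\alpha$. Assume $\diamondsuit^+$. Then for every ladder system $\mathbf C$ there is an Aronszajn tree $T$ such that every monochromatic $\omega$-colouring of $\mathbf C$ has a $T$-uniformization, but some $2$-colouring of $\mathbf C$ has no $T$-uniformization. -/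

import Mathlib

open scoped Ordinal

namespace TreeUnif

/-! ### The first uncountable ordinal, ladder systems and colourings -/

/-- The set `ω₁` of all countable ordinals. -/
abbrev Omega1 : Type 1 := Set.Iio (ω₁ : Ordinal.{0})

/-- `lim ω₁`: the countable limit ordinals (zero is not a limit ordinal). -/
abbrev LimOmega1 : Type 1 := {α : Omega1 // Order.IsSuccLimit α}

/-- A ladder system on `ω₁`: for each countable limit ordinal `α`, a cofinal subset `C_α` of `α`
of order type `ω`. -/
structure LadderSystem where
  ladder : LimOmega1 → Set Omega1
  lt_of_mem : ∀ (α : LimOmega1), ∀ ξ ∈ ladder α, ξ < α.1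
  cofinal : ∀ (α : LimOmega1) (β : Omega1), β < α.1 → ∃ ξ ∈ ladder α, β ≤ ξ
  type_omega : ∀ α : LimOmega1, Nonempty (ℕ ≃o ladder α)

/-- A colouring `(f_α)` of the ladder system `C` with colours in `K`: maps `f_α : C_α → K`.
An `n`-colouring is one with `K = Fin n`, an `ω`-colouring one with `K = ℕ`. -/
def LadderSystem.Colouring (C : LadderSystem) (K : Type) : Type 1 :=
  ∀ α : LimOmega1, C.ladder α → K

/-- A colouring is monochromatic if each `f_α` is constant. -/
def LadderSystem.Colouring.Monochromatic {C : LadderSystem} {K : Type} (f : C.Colouring K) :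
    Prop :=
  ∀ α : LimOmega1, ∃ k : K, ∀ ξ : C.ladder α, f α ξ = k

/-! ### Trees -/

/-- A (set-theoretic) tree: a partial order in which `t↓ = {s | s < t}` is well ordered
for every `t`. -/
class IsSetTree (T : Type) [PartialOrder T] : Prop where
  wellOrder_below (t : T) : IsWellOrder (Set.Iio t) (· < ·)

section Tree

variable {T : Type} [PartialOrder T] [IsSetTree T]

instance isWellOrder_below (t : T) : IsWellOrder (Set.Iio t) (· < ·) :=
  IsSetTree.wellOrder_below t

/-- The height of a node `t`: the order type of the set of its strict predecessors. -/
noncomputable def height (t : T) : Ordinal.{0} :=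
  Ordinal.type (α := Set.Iio t) (· < ·)

/-- The height of a node below `t` is its position in `t↓`. -/
theorem height_eq_typein {t : T} (s : Set.Iio t) :
    height s.1 = Ordinal.typein (α := Set.Iio t) (· < ·) s := by
  rw [← Ordinal.type_subrel]
  refine Quotient.sound ⟨⟨⟨fun x => ⟨⟨x.1, lt_trans x.2 s.2⟩, x.2⟩, fun y => ⟨y.1.1, y.2⟩,
    fun _ => rfl, fun _ => rfl⟩, Iff.rfl⟩⟩

theorem existsUnique_below {t : T} {ξ : Ordinal.{0}} (h : ξ < height t) :
    ∃! s : T, s < t ∧ height s = ξ := by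
  obtain ⟨s, hs⟩ := (Ordinal.mem_range_typein_iff (α := Set.Iio t) (· < ·)).2 h
  refine ⟨s.1, ⟨s.2, (height_eq_typein s).trans hs⟩, ?_⟩
  rintro r ⟨hr, hrξ⟩
  have h1 := height_eq_typein (t := t) ⟨r, hr⟩
  have h2 : (⟨r, hr⟩ : Set.Iio t) = s :=
    (Ordinal.typein_inj (α := Set.Iio t) (· < ·)).1 (h1.symm.trans (hrξ.trans hs.symm))
  exact congrArg Subtype.val h2

/-- `t ↾ ξ`: the unique predecessor of `t` of height `ξ`, for `ξ` below the height of `t`. -/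
noncomputable def restrict (t : T) (ξ : Ordinal.{0}) (h : ξ < height t) : T :=
  (existsUnique_below h).choose

theorem restrict_lt (t : T) (ξ : Ordinal.{0}) (h : ξ < height t) : restrict t ξ h < t :=
  (existsUnique_below h).choose_spec.1.1

theorem height_restrict (t : T) (ξ : Ordinal.{0}) (h : ξ < height t) :
    height (restrict t ξ h) = ξ :=
  (existsUnique_below h).choose_spec.1.2

variable (T) in
/-- The `α`th level of `T`. -/
def level (α : Ordinal.{0}) : Set T := {t | height t = α}

variable (T) in
/-- An Aronszajn tree: a tree of height `ω₁` (the least `α` whose level is empty) with countable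
levels and no uncountable chains. -/
structure IsAronszajn : Prop where
  height_eq : IsLeast {α : Ordinal.{0} | level T α = ∅} ω₁
  countable_level : ∀ α : Ordinal.{0}, (level T α).Countable
  countable_chain : ∀ A : Set T, IsChain (· ≤ ·) A → A.Countable

/-- A subtree of a tree `T` of height `ω₁`: a nonempty, downward closed set `S` that is pruned,
i.e. each node of `S` has extensions in `S` of arbitrarily large height below `ω₁`. -/
structure IsSubtree (S : Set T) : Prop where
  nonempty : S.Nonempty
  lower : IsLowerSet S
  pruned : ∀ s ∈ S, ∀ α < (ω₁ : Ordinal.{0}), ∃ t ∈ S, s ≤ t ∧ α ≤ height t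

/-- `s ↾ ξ` as a node of the subtree `S`. -/
noncomputable def IsSubtree.restrict {S : Set T} (hS : IsSubtree S) (s : S) (ξ : Ordinal.{0})
    (h : ξ < height s.1) : S :=
  ⟨TreeUnif.restrict s.1 ξ h, hS.lower (restrict_lt s.1 ξ h).le s.2⟩

/-- `φ`, defined on the subtree `S` of `T`, uniformizes the colouring `f`: for each node `s ∈ S` of
limit height `α < ω₁`, `φ (s ↾ ξ) = f_α(ξ)` for all but finitely many `ξ ∈ C_α`. -/
def Uniformizes {C : LadderSystem} {K : Type} (f : C.Colouring K) {S : Set T}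
    (hS : IsSubtree S) (φ : S → K) : Prop :=
  ∀ (s : S) (α : LimOmega1) (hs : height s.1 = (α.1 : Ordinal.{0})),
    {ξ : C.ladder α |
      φ (hS.restrict s (ξ.1 : Ordinal.{0}) (hs ▸ C.lt_of_mem α ξ.1 ξ.2)) ≠ f α ξ}.Finite

variable (T) in
/-- The colouring `f` has a `T`-uniformization. -/
def HasUniformization {C : LadderSystem} {K : Type} (f : C.Colouring K) : Prop :=
  ∃ (S : Set T) (hS : IsSubtree S) (φ : S → K), Uniformizes f hS φ

variable (T) in
/-- Every colouring of `C` with colours in `K` has a `T`-uniformization. -/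
def Unif (K : Type) (C : LadderSystem) : Prop :=
  ∀ f : C.Colouring K, HasUniformization T f

variable (T) in
/-- Every monochromatic colouring of `C` with colours in `K` has a `T`-uniformization. -/
def UnifConst (K : Type) (C : LadderSystem) : Prop :=
  ∀ f : C.Colouring K, f.Monochromatic → HasUniformization T f

end Tree

/-- The principle `◇⁺`: there are countable families `W_α` (`α < ω₁`) such that for every `X ⊆ ω₁`
there is a closed unbounded `D ⊆ ω₁` with `X ∩ α ∈ W_α` and `D ∩ α ∈ W_α` for all `α ∈ D`. -/
def DiamondPlus : Prop :=
  ∃ W : Omega1 → Set (Set Omega1),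
    (∀ α, (W α).Countable) ∧
    ∀ X : Set Omega1, ∃ D : Set Omega1, IsClub D ∧
      ∀ α ∈ D, X ∩ Set.Iio α ∈ W α ∧ D ∩ Set.Iio α ∈ W α

end TreeUnif

/-! Nodes of height ξ are functions on [0, ξ] that are finite-to-one below ξ and whose restriction
to each γ ≤ ξ is on a countable list `E γ`. Levels are then countable, and an uncountable chain
would glue to a function from ω₁ to ℕ with countable fibres. The lists are built by recursion: level
δ receives a branch for every satisfiable demand, which prescribes an initial segment and lower
bounds on later values, and asks that a guessed pair (constant colours g, club D) be uniformized.

Given g, ◇⁺ yields a club D of limits such that g and D are guessed below each δ ∈ D. The node b ↾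
[0, ξ] is coloured using only data below ν = `next D ξ`: a ladder α < ν through ξ captures the node
if the node follows some `E α n` of small enough index, and the capturing ladder of least priority
`e ν α` decides; an uncaptured node reads its colour off its last value. If α ∉ D, then ν is
eventually constant along the ladder of α and exceeds α. Ladders are almost disjoint, so α wins at
almost all its points, on every branch (`finite_colour_ne`). If δ ∈ D, then ν ≤ δ and δ never
captures its own points. But a large last value escapes the finitely many possible captures and can
encode any colour (`exists_free_value`), so uniformizing branches exist, and the guess has put such
branches on the list (`exists_good_continuation`). Hence the good nodes form a subtree. At δ the
guess is completed by the single number g δ, which has countably many options. An arbitrary f_δ has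
too many, and a 2-colouring can diagonalize against all guessed uniformizations
(`BranchTree.not_unif`). -/

namespace TreeUnif

/-! ### Branches, the colouring rule, and the recursion producing the levels -/

section Core

universe u
variable {I : Type u} [LinearOrder I]

/-- `b` restricted to the initial segment below `δ` is a branch of the tree whose level `γ` is
enumerated by `E γ`, and it is finite-to-one. -/
def Branch (E : I → ℕ → I → ℕ) (δ : I) (b : I → ℕ) : Prop :=
  (∀ γ ≤ δ, ∃ n, Set.EqOn b (E γ n) (Set.Iio γ)) ∧ ∀ v, {η | η < δ ∧ b η = v}.Finite

theorem Branch.mono {E : I → ℕ → I → ℕ} {δ γ : I} {b : I → ℕ} (h : Branch E δ b) (hγ : γ ≤ δ) :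
    Branch E γ b :=
  ⟨fun ζ hζ => h.1 ζ (hζ.trans hγ), fun v => (h.2 v).subset fun _ hη => ⟨hη.1.trans_le hγ, hη.2⟩⟩

theorem Branch.congr {E : I → ℕ → I → ℕ} {δ : I} {b c : I → ℕ} (h : Branch E δ b)
    (hbc : Set.EqOn b c (Set.Iio δ)) : Branch E δ c := by
  refine ⟨fun γ hγ => ?_, fun v => (h.2 v).subset fun η hη => ⟨hη.1, (hbc hη.1).trans hη.2⟩⟩
  obtain ⟨n, hn⟩ := h.1 γ hγ
  exact ⟨n, fun η hη => (hbc (lt_of_lt_of_le hη hγ)).symm.trans (hn hη)⟩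

/-- The node `b ↾ [0, ξ]` is captured by the ladder of `α < ν`, with priority `i`. -/
def Captures (E : I → ℕ → I → ℕ) (L : I → Set I) (e : I → I → ℕ) (ν ξ : I) (b : I → ℕ)
    (i : ℕ) (α : I) : Prop :=
  α < ν ∧ ξ ∈ L α ∧ e ν α = i ∧ ∃ n, Nat.pair i n < e ν ξ ∧ Set.EqOn b (E α n) (Set.Iic ξ)

open Classical in
/-- The value of `g` at the index of least priority in the relation `R`, or `z` if `R` is empty. -/
noncomputable def leastValue (R : ℕ → I → Prop) (g : I → ℕ) (z : ℕ) : ℕ :=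
  if h : ∃ i α, R i α then g (Classical.choose (Nat.find_spec h)) else z

/-- The colour of the node `b ↾ [0, ξ]`: the colour required by the capturing ladder of least
priority if there is one, and otherwise the first component of the last value. -/
noncomputable def colour (E : I → ℕ → I → ℕ) (L : I → Set I) (e : I → I → ℕ) (g : I → ℕ)
    (ν ξ : I) (b : I → ℕ) : ℕ :=
  leastValue (Captures E L e ν ξ b) g (Nat.unpair (b ξ)).1

-- The choice inside `leastValue` depends only on the relation, so equality of the capture relations
-- makes the same ladder be chosen on both sides.
open Classical in
theorem colour_congr {E E' : I → ℕ → I → ℕ} {L : I → Set I} {e : I → I → ℕ} {g g' : I → ℕ}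
    {ν ξ : I} {b b' : I → ℕ} (hE : ∀ α < ν, E α = E' α) (hg : ∀ α < ν, g α = g' α)
    (hb : Set.EqOn b b' (Set.Iic ξ)) : colour E L e g ν ξ b = colour E' L e g' ν ξ b' := by
  have hC : Captures E L e ν ξ b = Captures E' L e ν ξ b' := by
    funext i α
    unfold Captures
    refine propext (and_congr_right fun hα => ?_)
    rw [hE α hα]
    refine and_congr_right fun _ => and_congr_right fun _ => exists_congr fun n =>
      and_congr_right fun _ => ⟨fun h => hb.symm.trans h, fun h => hb.trans h⟩
  rw [colour, colour, hC, hb (Set.mem_Iic.2 le_rfl)]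
  unfold leastValue
  split_ifs with h
  · exact hg _ (Classical.choose_spec (Nat.find_spec h)).1
  · rfl

theorem colour_eq {E : I → ℕ → I → ℕ} {L : I → Set I} {e : I → I → ℕ} {g : I → ℕ}
    {ν ξ α : I} {b : I → ℕ} (he : Set.InjOn (e ν) (Set.Iio ν))
    (hα : Captures E L e ν ξ b (e ν α) α)
    (hmin : ∀ α', α' < ν → e ν α' < e ν α → ξ ∉ L α') : colour E L e g ν ξ b = g α := by
  classical
  have h : ∃ i α, Captures E L e ν ξ b i α := ⟨_, _, hα⟩
  rw [colour, leastValue, dif_pos h]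
  have hs := Classical.choose_spec (Nat.find_spec h)
  congr 1
  refine he hs.1 hα.1 (hs.2.2.1.trans ?_)
  refine le_antisymm (Nat.find_min' h ⟨_, hα⟩) ?_
  by_contra! hlt
  exact hmin _ hs.1 (hs.2.2.1.trans_lt hlt) hs.2.1

/-- Injectivity of `e ν` leaves only finitely many pairs (α, n) with code below `e ν ξ`. A value at
ξ exceeding every corresponding `E α n ξ` rules out capture, and its first unpaired component is
then the colour. -/
theorem exists_free_value (E : I → ℕ → I → ℕ) (L : I → Set I) {e : I → I → ℕ} (g : I → ℕ)
    {ν : I} (ξ : I) (he : Set.InjOn (e ν) (Set.Iio ν)) (M k : ℕ) :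
    ∃ v, M ≤ v ∧ ∀ b : I → ℕ, b ξ = v → colour E L e g ν ξ b = k := by
  have hfin : {x : I × ℕ | x.1 < ν ∧ Nat.pair (e ν x.1) x.2 < e ν ξ}.Finite := by
    refine Set.Finite.of_finite_image (f := fun x => Nat.pair (e ν x.1) x.2)
      ((Set.finite_Iio (e ν ξ)).subset ?_) ?_
    · rintro _ ⟨x, hx, rfl⟩
      exact hx.2
    · rintro ⟨x, n⟩ hx ⟨y, m⟩ hy hxy
      obtain ⟨h1, h2⟩ := Nat.pair_eq_pair.1 hxy
      exact Prod.ext (he hx.1 hy.1 h1) h2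
  obtain ⟨B, hB⟩ := (hfin.image fun x => E x.1 x.2 ξ).bddAbove
  refine ⟨Nat.pair k (max M (B + 1)), (le_max_left _ _).trans (Nat.right_le_pair _ _), ?_⟩
  intro b hb
  rw [colour, leastValue, dif_neg, hb, Nat.unpair_pair]
  rintro ⟨i, α, hα, -, rfl, n, hn, hbE⟩
  have h1 : E α n ξ ≤ B := hB ⟨(α, n), ⟨hα, hn⟩, rfl⟩
  have h2 := hbE (Set.mem_Iic.2 le_rfl)
  have h3 := (le_max_right M (B + 1)).trans (Nat.right_le_pair k _)
  omega

variable [WellFoundedLT I]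

open Classical in
/-- The least element of `D` above `ξ` (and `ξ` if there is none). -/
noncomputable def next (D : Set I) (ξ : I) : I :=
  if h : {d | d ∈ D ∧ ξ < d}.Nonempty then wellFounded_lt.min {d | d ∈ D ∧ ξ < d} h else ξ

theorem next_le {D : Set I} {ξ d : I} (hd : d ∈ D) (h : ξ < d) : next D ξ ≤ d := by
  have hne : {d | d ∈ D ∧ ξ < d}.Nonempty := ⟨d, hd, h⟩
  rw [next, dif_pos hne]
  exact wellFounded_lt.min_le (s := {d | d ∈ D ∧ ξ < d}) ⟨hd, h⟩

theorem next_spec {D : Set I} {ξ d : I} (hd : d ∈ D) (h : ξ < d) :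
    next D ξ ∈ D ∧ ξ < next D ξ := by
  have hne : {d | d ∈ D ∧ ξ < d}.Nonempty := ⟨d, hd, h⟩
  rw [next, dif_pos hne]
  exact wellFounded_lt.min_mem _ hne

theorem next_congr {D D' : Set I} {ξ d : I} (hd : d ∈ D) (h : ξ < d)
    (hDD : ∀ γ ≤ d, γ ∈ D' ↔ γ ∈ D) : next D' ξ = next D ξ := by
  have hd' : d ∈ D' := (hDD d le_rfl).2 hd
  refine le_antisymm (next_le ?_ (next_spec hd h).2) (next_le ?_ (next_spec hd' h).2)
  · exact (hDD _ (next_le hd h)).2 (next_spec hd h).1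
  · exact (hDD _ (next_le hd' h)).1 (next_spec hd' h).1

/-- The colours of the initial segments of `b ↾ δ` uniformize the constant colours `g γ` at all
`γ ≤ δ` in `D`. -/
def Good (E : I → ℕ → I → ℕ) (L : I → Set I) (e : I → I → ℕ) (D : Set I) (g : I → ℕ) (δ : I)
    (b : I → ℕ) : Prop :=
  ∀ γ ≤ δ, γ ∈ D → {ξ | ξ ∈ L γ ∧ colour E L e g (next D ξ) ξ b ≠ g γ}.Finite

theorem Good.mono {E : I → ℕ → I → ℕ} {L : I → Set I} {e : I → I → ℕ} {D : Set I} {g : I → ℕ}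
    {δ γ : I} {b : I → ℕ} (h : Good E L e D g δ b) (hγ : γ ≤ δ) : Good E L e D g γ b :=
  fun ζ hζ => h ζ (hζ.trans hγ)

/-- A point ξ tested at γ ∈ D has `next D ξ ≤ γ ≤ δ`, so goodness up to δ reads only `E` below δ and
g, D up to δ. This permits the recursion on levels and the replacement of (g, D) by a guess. -/
theorem Good.congr {E E' : I → ℕ → I → ℕ} {L : I → Set I} {e : I → I → ℕ} {D D' : Set I}
    {g g' : I → ℕ} {δ : I} {b b' : I → ℕ} (hL : ∀ γ, ∀ ξ ∈ L γ, ξ < γ)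
    (h : Good E L e D g δ b)
    (hE : ∀ γ < δ, E γ = E' γ) (hD : ∀ γ ≤ δ, γ ∈ D' ↔ γ ∈ D) (hg : ∀ γ ≤ δ, g γ = g' γ)
    (hb : Set.EqOn b b' (Set.Iio δ)) : Good E' L e D' g' δ b' := by
  intro γ hγ hγD'
  have hγD := (hD γ hγ).1 hγD'
  refine (h γ hγ hγD).subset ?_
  rintro ξ ⟨hξ, hne⟩
  have hξγ := hL γ ξ hξ
  refine ⟨hξ, fun heq => hne ?_⟩
  rw [next_congr hγD hξγ fun ζ hζ => hD ζ (hζ.trans hγ), ← hg γ hγ, ← heq]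
  have hν : next D ξ ≤ δ := (next_le hγD hξγ).trans hγ
  refine (colour_congr (fun α hα => hE α (hα.trans_le hν))
    (fun α hα => hg α (hα.trans_le hν).le) fun η hη => hb ?_).symm
  exact lt_of_le_of_lt hη (hξγ.trans_le hγ)

/-- The conditions imposed on the branch of length `δ` added for the parameters `p`. -/
def Admissible (L : I → Set I) (e : I → I → ℕ) (a : I → ℕ → I) (G : I → ℕ → (I → ℕ) × Set I)
    (E : I → ℕ → I → ℕ) (δ : I) (p : ℕ × ℕ × ℕ × ℕ × ℕ) (b : I → ℕ) : Prop :=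
  ((∀ γ < δ, ∃ n, Set.EqOn b (E γ n) (Set.Iio γ)) ∧ ∀ v, {η | η < δ ∧ b η = v}.Finite) ∧
  (a δ p.1 < δ ∧ Set.EqOn b (E (a δ p.1) p.2.1) (Set.Iio (a δ p.1)) ∧ b (a δ p.1) = p.2.2.1 ∧
    ∀ η, a δ p.1 < η → η < δ → p.2.2.2.1 ≤ b η) ∧
  Good E L e (G δ p.2.2.2.2).2 (G δ p.2.2.2.2).1 δ b

theorem Admissible.congr {L : I → Set I} {e : I → I → ℕ} {a : I → ℕ → I}
    {G : I → ℕ → (I → ℕ) × Set I} {E E' : I → ℕ → I → ℕ} {δ : I} {p : ℕ × ℕ × ℕ × ℕ × ℕ}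
    {b : I → ℕ} (hL : ∀ γ, ∀ ξ ∈ L γ, ξ < γ) (hE : ∀ γ < δ, E γ = E' γ)
    (h : Admissible L e a G E δ p b) : Admissible L e a G E' δ p b := by
  obtain ⟨⟨h1, h2⟩, ⟨h3, h4, h5⟩, h6⟩ := h
  refine ⟨⟨fun γ hγ => hE γ hγ ▸ h1 γ hγ, h2⟩, ⟨h3, hE _ h3 ▸ h4, h5⟩, ?_⟩
  exact h6.congr hL hE (fun _ _ => Iff.rfl) (fun _ _ => rfl) fun _ _ => rfl

/-- Well-founded recursion: the parameters are countable in number, and the entry of `E δ` at the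
code of p is a witness for p whenever one exists. Admissibility at δ depends only on earlier levels.
-/
theorem exists_levels (L : I → Set I) (e : I → I → ℕ) (a : I → ℕ → I)
    (G : I → ℕ → (I → ℕ) × Set I) (hL : ∀ γ, ∀ ξ ∈ L γ, ξ < γ) :
    ∃ E : I → ℕ → I → ℕ, ∀ δ p, (∃ b, Admissible L e a G E δ p b) →
      ∃ n, Admissible L e a G E δ p (E δ n) := by
  classical
  let tr : (δ : I) → ((γ : I) → γ < δ → ℕ → I → ℕ) → I → ℕ → I → ℕ :=
    fun δ F γ => if h : γ < δ then F γ h else fun _ _ => 0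
  let step : (δ : I) → ((γ : I) → γ < δ → ℕ → I → ℕ) → ℕ → I → ℕ := fun δ F n =>
    if h : ∃ b, Admissible L e a G (tr δ F) δ (Denumerable.ofNat _ n) b then h.choose
    else fun _ => 0
  let E : I → ℕ → I → ℕ := wellFounded_lt.fix step
  have hE : ∀ δ, E δ = step δ fun γ _ => E γ := fun δ => wellFounded_lt.fix_eq step δ
  refine ⟨E, fun δ p hp => ⟨Encodable.encode p, ?_⟩⟩
  have htr : ∀ γ < δ, E γ = tr δ (fun γ _ => E γ) γ := fun γ hγ => by simp only [tr, dif_pos hγ]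
  have hp' : ∃ b, Admissible L e a G (tr δ fun γ _ => E γ) δ p b :=
    hp.imp fun b hb => hb.congr hL htr
  have hEp : E δ (Encodable.encode p) = hp'.choose := by
    rw [hE]
    simp only [step, Denumerable.ofNat_encode]
    exact dif_pos hp'
  rw [hEp]
  exact hp'.choose_spec.congr hL fun γ hγ => (htr γ hγ).symm

end Core

/-! ### Extending branches, with and without the uniformization demand -/

section Extension

universe u
variable {I : Type u} [LinearOrder I]

/-- `c` continues the node given by `b ↾ α` and the value `v` at `α`, with values at least `N`
above `α`. -/
def Continues (α : I) (b : I → ℕ) (v N : ℕ) (γ : I) (c : I → ℕ) : Prop :=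
  Set.EqOn c b (Set.Iio α) ∧ c α = v ∧ ∀ η, α < η → η < γ → N ≤ c η

/-- Extend successively along a cofinal sequence, at each point choosing a value that forces `Q`,
and raising the lower bound on all later values by one each time. The growing bounds keep the union
finite-to-one. -/
theorem exists_limit_branch {E : I → ℕ → I → ℕ} {β : I} {x : ℕ → I} (hx : StrictMono x)
    (hxβ : ∀ n, x n < β) (hcof : ∀ γ < β, ∃ n, γ ≤ x n) (P : I → (I → ℕ) → Prop)
    (hmono : ∀ γ δ b, γ ≤ δ → P δ b → P γ b)
    (hcongr : ∀ γ b b', P γ b → Set.EqOn b b' (Set.Iio γ) → P γ b')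
    (Q : I → (I → ℕ) → Prop) (hQ : ∀ ξ < β, ∀ M, ∃ v, M ≤ v ∧ ∀ b : I → ℕ, b ξ = v → Q ξ b)
    (hext : ∀ γ < β, ∀ α < γ, ∀ b, Branch E α b → P α b → ∀ v N,
      ∃ c, Branch E γ c ∧ P γ c ∧ Continues α b v N γ c)
    {α : I} (hα : α < β) {b : I → ℕ} (hb : Branch E α b) (hP : P α b) (v N : ℕ) :
    ∃ c, (∀ γ < β, Branch E γ c ∧ P γ c) ∧ (∀ w, {η | η < β ∧ c η = w}.Finite) ∧
      Continues α b v N β c ∧ {n | ¬ Q (x n) c}.Finite := by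
  classical
  obtain ⟨n₀, hn₀⟩ := hcof α hα
  -- Only the tail of the sequence lying above α is used; the first n₀ + 1 points are the possible
  -- failures of `Q`.
  obtain ⟨y, hy⟩ : ∃ y : ℕ → I, ∀ n, y n = x (n₀ + 1 + n) := ⟨_, fun _ => rfl⟩
  have hymono : StrictMono y := fun m n hmn => by
    rw [hy, hy]
    exact hx (by omega)
  have hyβ : ∀ n, y n < β := fun n => by
    rw [hy]
    exact hxβ _
  have hycof : ∀ γ < β, ∃ n, γ < y n := fun γ hγ => by
    obtain ⟨n, hn⟩ := hcof γ hγ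
    refine ⟨n, hn.trans_lt ?_⟩
    rw [hy]
    exact hx (by omega)
  have hαy : ∀ n, α < y n := fun n => by
    rw [hy]
    exact hn₀.trans_lt (hx (by omega))
  choose! val hval using hQ
  obtain ⟨c₀, hc₀b, hc₀P, hc₀⟩ := hext (y 0) (hyβ 0) α (hαy 0) b hb hP v N
  have hstep : ∀ n c, Branch E (y n) c ∧ P (y n) c → ∃ c', (Branch E (y (n + 1)) c' ∧
      P (y (n + 1)) c') ∧ Continues (y n) c (val (y n) (N + n)) (N + n) (y (n + 1)) c' := by
    rintro n c ⟨h1, h2⟩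
    obtain ⟨c', h3, h4, h5⟩ := hext (y (n + 1)) (hyβ _) (y n) (hymono n.lt_succ_self) c h1 h2
      (val (y n) (N + n)) (N + n)
    exact ⟨c', ⟨h3, h4⟩, h5⟩
  choose! F hF using hstep
  obtain ⟨c, hc0, hcs⟩ : ∃ c : ℕ → I → ℕ, c 0 = c₀ ∧ ∀ n, c (n + 1) = F n (c n) :=
    ⟨fun n => Nat.rec c₀ F n, rfl, fun _ => rfl⟩
  have hc : ∀ n, Branch E (y n) (c n) ∧ P (y n) (c n) := by
    intro n
    induction n with
    | zero => exact hc0 ▸ ⟨hc₀b, hc₀P⟩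
    | succ n ih => exact hcs n ▸ (hF n _ ih).1
  have hcc : ∀ n, Continues (y n) (c n) (val (y n) (N + n)) (N + n) (y (n + 1)) (c (n + 1)) :=
    fun n => hcs n ▸ (hF n _ (hc n)).2
  have hcoh : ∀ m n, m ≤ n → Set.EqOn (c n) (c m) (Set.Iio (y m)) := by
    intro m n hmn
    induction n, hmn using Nat.le_induction with
    | base => exact fun _ _ => rfl
    | succ n hmn ih =>
      exact fun η hη => ((hcc n).1 (lt_of_lt_of_le hη (hymono.monotone hmn))).trans (ih hη)
  obtain ⟨d, hd⟩ : ∃ d : I → ℕ, ∀ n η, η < y n → d η = c n η := by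
    refine ⟨fun η => if h : ∃ n, η < y n then c (Nat.find h) η else 0, fun n η hη => ?_⟩
    have h : ∃ n, η < y n := ⟨n, hη⟩
    simp only [dif_pos h]
    exact (hcoh _ _ (Nat.find_min' h hη) (Nat.find_spec h)).symm
  have hdy : ∀ n, d (y n) = val (y n) (N + n) := fun n =>
    (hd (n + 1) _ (hymono n.lt_succ_self)).trans (hcc n).2.1
  have hdN : ∀ n η, y n ≤ η → η < β → N + n ≤ d η := by
    intro n η hη hηβ
    have h := hycof η hηβ
    have hne : Nat.find h ≠ 0 := fun h0 => by
      have := Nat.find_spec h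
      rw [h0] at this
      exact absurd (this.trans_le (hymono.monotone (Nat.zero_le n))) (not_lt.2 hη)
    obtain ⟨k, hk⟩ := Nat.exists_eq_succ_of_ne_zero hne
    have h1 : η < y (k + 1) := by
      have := Nat.find_spec h
      rwa [hk] at this
    have h2 : y k ≤ η := not_lt.1 (Nat.find_min h (by omega))
    have hnk : n ≤ k := by
      by_contra! hlt
      exact absurd (h1.trans_le (hymono.monotone hlt)) (not_lt.2 hη)
    rcases h2.eq_or_lt with rfl | h2
    · rw [hdy]
      have := (hval _ hηβ (N + k)).1
      omega
    · rw [hd _ _ h1]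
      have := (hcc k).2.2 η h2 h1
      omega
  refine ⟨d, fun γ hγ => ?_, fun w => ?_, ⟨fun η hη => ?_, ?_, fun η hη hηβ => ?_⟩, ?_⟩
  · obtain ⟨n, hn⟩ := hycof γ hγ
    have heq : Set.EqOn (c n) d (Set.Iio γ) := fun η hη => (hd n η (lt_trans hη hn)).symm
    exact ⟨((hc n).1.mono hn.le).congr heq, hcongr _ _ _ (hmono _ _ _ hn.le (hc n).2) heq⟩
  · refine ((hc (w + 1)).1.2 w).subset ?_
    rintro η ⟨hη, hw⟩
    have hlt : η < y (w + 1) := by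
      by_contra! hle
      have := hdN _ _ hle hη
      omega
    exact ⟨hlt, (hd _ _ hlt).symm.trans hw⟩
  · exact (hd 0 η (lt_trans hη (hαy 0))).trans (hc0 ▸ hc₀.1 hη)
  · exact (hd 0 α (hαy 0)).trans (hc0 ▸ hc₀.2.1)
  · rcases lt_or_ge η (y 0) with h | h
    · exact (hd 0 η h).symm ▸ hc0 ▸ hc₀.2.2 η hη h
    · exact hdN 0 η h hηβ
  · refine (Set.finite_Iic n₀).subset fun n hn => ?_
    by_contra hlt
    simp only [Set.mem_Iic, not_le] at hlt
    obtain ⟨k, rfl⟩ := Nat.exists_eq_add_of_le (Nat.succ_le_of_lt hlt)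
    refine hn ?_
    have hk := hdy k
    rw [hy] at hk
    exact (hval _ (hxβ _) (N + k)).2 d hk

variable [WellFoundedLT I] {L : I → Set I} {e : I → I → ℕ} {a : I → ℕ → I}
  {G : I → ℕ → (I → ℕ) × Set I} {E : I → ℕ → I → ℕ}

/-- The limit function c need not itself be listed at δ, but it witnesses that a demand is
satisfiable, so some listed branch meets the same demand and replaces it. -/
theorem exists_branch (ha : ∀ δ, ∀ α < δ, ∃ i, a δ i = α)
    (hE : ∀ δ p, (∃ b, Admissible L e a G E δ p b) → ∃ n, Admissible L e a G E δ p (E δ n))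
    {α δ : I} {b c : I → ℕ} {v N q : ℕ} (hα : α < δ) (hc : ∀ γ < δ, Branch E γ c)
    (hfin : ∀ w, {η | η < δ ∧ c η = w}.Finite) (hbc : Continues α b v N δ c)
    (hgood : Good E L e (G δ q).2 (G δ q).1 δ c) :
    ∃ c', Branch E δ c' ∧ Good E L e (G δ q).2 (G δ q).1 δ c' ∧ Continues α b v N δ c' := by
  obtain ⟨i, hi⟩ := ha δ α hα
  obtain ⟨m, hm⟩ := (hc α hα).1 α le_rfl
  obtain ⟨n, ⟨h1, h2⟩, ⟨h3, h4, h5, h6⟩, h7⟩ := hE δ (i, m, v, N, q)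
    ⟨c, ⟨fun γ hγ => (hc γ hγ).1 γ le_rfl, hfin⟩, ⟨by simpa [hi] using hα, by simpa [hi] using hm,
      by simpa [hi] using hbc.2.1, by simpa [hi] using hbc.2.2⟩, hgood⟩
  simp only [hi] at h3 h4 h5 h6
  refine ⟨E δ n, ⟨fun γ hγ => ?_, h2⟩, h7, ⟨?_, h5, h6⟩⟩
  · rcases hγ.eq_or_lt with rfl | hγ
    · exact ⟨n, fun _ _ => rfl⟩
    · exact h1 γ hγ
  · exact (h4.trans hm.symm).trans hbc.1

variable (hL : ∀ γ, ∀ ξ ∈ L γ, ξ < γ) (he : ∀ ν, Set.InjOn (e ν) (Set.Iio ν))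
  (hlad : ∀ β : I, Order.IsSuccLimit β → ∃ x : ℕ → I, StrictMono x ∧ Set.range x = L β ∧
    ∀ γ < β, ∃ n, γ ≤ x n)
  (ha : ∀ δ, ∀ α < δ, ∃ i, a δ i = α)
  (hE : ∀ δ p, (∃ b, Admissible L e a G E δ p b) → ∃ n, Admissible L e a G E δ p (E δ n))
  (hG : ∀ δ, ∃ q, (G δ q).2 = ∅)

include hL hlad ha hE hG in
theorem exists_continuation (β : I) : ∀ α < β, ∀ b, Branch E α b → ∀ v N,
    ∃ c, Branch E β c ∧ Continues α b v N β c := by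
  induction β using WellFoundedLT.induction with
  | ind β ih =>
  intro α hα b hb v N
  suffices h : ∃ c, (∀ γ < β, Branch E γ c) ∧ (∀ w, {η | η < β ∧ c η = w}.Finite) ∧
      Continues α b v N β c by
    obtain ⟨c, h1, h2, h3⟩ := h
    -- With the empty set as guessed club, goodness is vacuous.
    obtain ⟨q, hq⟩ := hG β
    obtain ⟨c', h4, -, h5⟩ := exists_branch (q := q) ha hE hα h1 h2 h3
      fun γ _ hγ => by simp [hq] at hγ
    exact ⟨c', h4, h5⟩
  by_cases hlim : ∃ β₀, β₀ ⋖ β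
  · obtain ⟨β₀, hβ₀⟩ := hlim
    have hlt : ∀ {γ}, γ < β → γ ≤ β₀ := fun hγ => not_lt.1 fun h => hβ₀.2 h hγ
    suffices h : ∃ c, Branch E β₀ c ∧ Continues α b v N β c by
      obtain ⟨c, h1, h2⟩ := h
      refine ⟨c, fun γ hγ => h1.mono (hlt hγ), fun w => ?_, h2⟩
      refine ((h1.2 w).union (Set.finite_singleton β₀)).subset ?_
      rintro η ⟨hη, hw⟩
      rcases (hlt hη).eq_or_lt with rfl | h
      · exact Or.inr rfl
      · exact Or.inl ⟨h, hw⟩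
    rcases (hlt hα).eq_or_lt with rfl | hαβ
    · refine ⟨Function.update b α v, hb.congr fun η hη => ?_, fun η hη => ?_, by simp, ?_⟩
      · exact (Function.update_of_ne (ne_of_lt hη) _ _).symm
      · exact Function.update_of_ne (ne_of_lt hη) _ _
      · exact fun η h1 h2 => absurd h2 (hβ₀.2 h1)
    · obtain ⟨c, h1, h2, h3, h4⟩ := ih β₀ hβ₀.1 α hαβ b hb v N
      refine ⟨Function.update c β₀ N, h1.congr fun η hη => ?_, fun η hη => ?_, ?_, ?_⟩
      · exact (Function.update_of_ne (ne_of_lt hη) _ _).symm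
      · exact (Function.update_of_ne (ne_of_lt (lt_trans hη hαβ)) _ _).trans (h2 hη)
      · exact (Function.update_of_ne (ne_of_lt hαβ) _ _).trans h3
      · intro η h5 h6
        rcases (hlt h6).eq_or_lt with rfl | h
        · simp
        · rw [Function.update_of_ne (ne_of_lt h)]
          exact h4 η h5 h
  · have hlim' : Order.IsSuccLimit β := ⟨fun h => (h.not_lt hα), fun γ hγ => hlim ⟨γ, hγ⟩⟩
    obtain ⟨x, hx, hxL, hcof⟩ := hlad β hlim'
    obtain ⟨c, h1, h2, h3, -⟩ := exists_limit_branch hx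
      (fun n => hL β _ (hxL ▸ Set.mem_range_self n)) hcof (fun _ _ => True)
      (fun _ _ _ _ _ => trivial) (fun _ _ _ _ _ => trivial) (fun _ _ => True)
      (fun _ _ M => ⟨M, le_rfl, fun _ _ => trivial⟩)
      (fun γ hγ α' hα' b' hb' _ v' N' => (ih γ hγ α' hα' b' hb' v' N').imp
        fun c hc => ⟨hc.1, trivial, hc.2⟩) hα hb trivial v N
    exact ⟨c, fun γ hγ => (h1 γ hγ).1, h2, h3⟩

-- This makes the good nodes a pruned tree. At β ∈ D, free values along the ladder give colour `g
-- β`, and the correct guess at β puts a suitable branch on the list. At β ∉ D, closedness gives ζ <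
-- β with no point of D in (ζ, β], so goodness is needed only up to ζ.
include hL he hlad ha hE hG in
theorem exists_good_continuation {D : Set I} {g : I → ℕ} (hDlim : ∀ δ ∈ D, Order.IsSuccLimit δ)
    (hDcl : ∀ δ, (∀ γ < δ, ∃ d ∈ D, γ < d ∧ d ≤ δ) → (∃ γ, γ < δ) → δ ∈ D)
    (hDG : ∀ δ ∈ D, ∃ q, ∀ γ ≤ δ, (G δ q).1 γ = g γ ∧ (γ ∈ (G δ q).2 ↔ γ ∈ D))
    (β : I) : ∀ α < β, ∀ b, Branch E α b → Good E L e D g α b → ∀ v N,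
    ∃ c, Branch E β c ∧ Good E L e D g β c ∧ Continues α b v N β c := by
  induction β using WellFoundedLT.induction with
  | ind β ih =>
  intro α hα b hb hbg v N
  by_cases hβ : β ∈ D
  · obtain ⟨x, hx, hxL, hcof⟩ := hlad β (hDlim β hβ)
    obtain ⟨c, h1, h2, h3, h4⟩ := exists_limit_branch hx
      (fun n => hL β _ (hxL ▸ Set.mem_range_self n)) hcof (Good E L e D g)
      (fun _ _ _ h1 h2 => h2.mono h1) (fun _ _ _ h1 h2 => h1.congr hL (fun _ _ => rfl)
        (fun _ _ => Iff.rfl) (fun _ _ => rfl) h2)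
      (fun ξ c => colour E L e g (next D ξ) ξ c = g β)
      (fun ξ _ M => exists_free_value E L g ξ (he _) M (g β)) ih hα hb hbg v N
    have hgood : Good E L e D g β c := by
      intro γ hγ hγD
      rcases hγ.eq_or_lt with rfl | hγ
      · refine (h4.image x).subset ?_
        rintro ξ ⟨hξ, hne⟩
        rw [← hxL] at hξ
        obtain ⟨n, rfl⟩ := hξ
        exact ⟨n, hne, rfl⟩
      · exact (h1 γ hγ).2 γ le_rfl hγD
    obtain ⟨q, hq⟩ := hDG β hβ
    obtain ⟨c', h5, h6, h7⟩ := exists_branch (q := q) ha hE hα (fun γ hγ => (h1 γ hγ).1) h2 h3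
      (hgood.congr hL (fun _ _ => rfl) (fun γ hγ => (hq γ hγ).2)
        (fun γ hγ => (hq γ hγ).1.symm) fun _ _ => rfl)
    exact ⟨c', h5, h6.congr hL (fun _ _ => rfl) (fun γ hγ => (hq γ hγ).2.symm)
        (fun γ hγ => (hq γ hγ).1) fun _ _ => rfl, h7⟩
  · have hdirect : ∀ μ < β, (∀ d ∈ D, μ < d → ¬ d ≤ β) → ∀ b', Branch E μ b' →
        Good E L e D g μ b' → ∀ v' N',
        ∃ c, Branch E β c ∧ Good E L e D g β c ∧ Continues μ b' v' N' β c := by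
      intro μ hμ hμD b' hb' hg' v' N'
      obtain ⟨c, h1, h2⟩ := exists_continuation hL hlad ha hE hG β μ hμ b' hb' v' N'
      refine ⟨c, h1, fun γ hγ hγD => ?_, h2⟩
      have hγμ : γ ≤ μ := not_lt.1 fun h => hμD γ hγD h hγ
      exact hg'.congr hL (fun _ _ => rfl) (fun _ _ => Iff.rfl) (fun _ _ => rfl) h2.1.symm
        γ hγμ hγD
    obtain ⟨ζ, hζ, hζD⟩ : ∃ ζ < β, ∀ d ∈ D, ζ < d → ¬ d ≤ β := by
      by_contra! h
      exact hβ (hDcl β h ⟨α, hα⟩)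
    rcases le_or_gt ζ α with h | h
    · exact hdirect α hα (fun d hd hlt => hζD d hd (h.trans_lt hlt)) b hb hbg v N
    · obtain ⟨b₁, h1, h2, h3, h4, h5⟩ := ih ζ hζ α h b hb hbg v N
      -- The value at ζ lies above α, so it too must respect the bound N.
      obtain ⟨c, h6, h7, h8, h9, h10⟩ := hdirect ζ hζ hζD b₁ h1 h2 N N
      refine ⟨c, h6, h7, fun η hη => (h8 (lt_trans hη h)).trans (h3 hη), (h8 h).trans h4, ?_⟩
      intro η hη hηβ
      rcases lt_trichotomy η ζ with h' | rfl | h'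
      · rw [h8 h']
        exact h5 η hη h'
      · exact h9.ge
      · exact h10 η h' hηβ

-- Outside D no care is needed in building branches. Beyond ζ all ladder points of α share the same
-- ν > α, and b follows one fixed `E α n`, so α captures at almost all of them; the finitely many
-- ladders of smaller priority meet that of α in finite sets.
include hL he hlad in
theorem finite_colour_ne (hLlim : ∀ γ, ∀ ξ ∈ L γ, Order.IsSuccLimit γ) {D : Set I} {g : I → ℕ}
    (hDcl : ∀ δ, (∀ γ < δ, ∃ d ∈ D, γ < d ∧ d ≤ δ) → (∃ γ, γ < δ) → δ ∈ D)
    (hDunb : ∀ γ, ∃ d ∈ D, γ < d) {α : I} (hα : Order.IsSuccLimit α) (hαD : α ∉ D)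
    {b : I → ℕ} (hb : Branch E α b) :
    {ξ | ξ ∈ L α ∧ colour E L e g (next D ξ) ξ b ≠ g α}.Finite := by
  have hfin : ∀ α, Order.IsSuccLimit α → ∀ γ < α, {ξ | ξ ∈ L α ∧ ξ ≤ γ}.Finite := by
    intro α hα γ hγ
    obtain ⟨x, hx, hxL, hcof⟩ := hlad α hα
    obtain ⟨n, hn⟩ := hcof γ hγ
    refine ((Set.finite_Iic n).image x).subset ?_
    rintro ξ ⟨hξ, hξγ⟩
    rw [← hxL] at hξ
    obtain ⟨m, rfl⟩ := hξ
    exact ⟨m, hx.le_iff_le.1 (hξγ.trans hn), rfl⟩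
  have hinter : ∀ α' ≠ α, {ξ | ξ ∈ L α ∧ ξ ∈ L α'}.Finite := by
    intro α' hne
    rcases lt_or_gt_of_ne hne with h | h
    · exact (hfin α hα α' h).subset fun ξ hξ => ⟨hξ.1, (hL _ _ hξ.2).le⟩
    · by_cases hα' : Order.IsSuccLimit α'
      · exact (hfin α' hα' α h).subset fun ξ hξ => ⟨hξ.2, (hL _ _ hξ.1).le⟩
      · exact Set.finite_empty.subset fun ξ hξ => hα' (hLlim _ _ hξ.2)
  obtain ⟨ζ, hζ, hζD⟩ : ∃ ζ < α, ∀ d ∈ D, ζ < d → ¬ d ≤ α := by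
    by_contra! h
    obtain ⟨γ, hγ⟩ := not_isMin_iff.1 hα.1
    exact hαD (hDcl α h ⟨γ, hγ⟩)
  obtain ⟨d, hd, hαd⟩ := hDunb α
  obtain ⟨n, hn⟩ := hb.1 α le_rfl
  set ν := next D α with hν
  have hνα : α < ν := (next_spec hd hαd).2
  have hnext : ∀ ξ, ζ < ξ → ξ < α → next D ξ = ν := by
    intro ξ h1 h2
    refine le_antisymm (next_le (next_spec hd hαd).1 (h2.trans hνα)) (next_le ?_ ?_)
    · exact (next_spec hd (h2.trans hαd)).1
    · have h3 := next_spec hd (h2.trans hαd)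
      exact not_le.1 (hζD _ h3.1 (h1.trans h3.2))
  have hsmall : ∀ i, {ξ | ξ < ν ∧ e ν ξ ≤ i}.Finite := fun i =>
    Set.Finite.of_finite_image ((Set.finite_Iic i).subset (by rintro _ ⟨ξ, hξ, rfl⟩; exact hξ.2))
      ((he ν).mono fun ξ hξ => hξ.1)
  have hbad : (⋃ α' ∈ {ξ | ξ < ν ∧ e ν ξ ≤ e ν α} \ {α}, {ξ | ξ ∈ L α ∧ ξ ∈ L α'}).Finite :=
    (hsmall _).sdiff.biUnion fun α' hα' => hinter α' hα'.2
  refine (((hfin α hα ζ hζ).union (hsmall (Nat.pair (e ν α) n))).union hbad).subset ?_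
  rintro ξ ⟨hξ, hne⟩
  by_contra hcon
  simp only [Set.mem_union, not_or] at hcon
  obtain ⟨⟨h1, h2⟩, h3⟩ := hcon
  have hξα := hL α ξ hξ
  have hζξ : ζ < ξ := not_le.1 fun h => h1 ⟨hξ, h⟩
  rw [hnext ξ hζξ hξα] at hne
  refine hne (colour_eq (he ν) ⟨hνα, hξ, rfl, n, ?_, ?_⟩ ?_)
  · exact not_le.1 fun h => h2 ⟨hξα.trans hνα, h⟩
  · exact fun η hη => hn (lt_of_le_of_lt hη hξα)
  · intro α' h4 h5 h6
    refine h3 (Set.mem_biUnion ⟨⟨h4, h5.le⟩, ?_⟩ ⟨hξ, h6⟩)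
    rintro rfl
    exact lt_irrefl _ h5

end Extension

/-! ### Countable ordinals, clubs, and the guessing form of ◇⁺ -/

section Omega1

theorem Omega1.add_lt (α : Omega1) {β : Ordinal.{0}} (hβ : β < ω₁) :
    (α : Ordinal.{0}) + β < ω₁ :=
  Ordinal.isPrincipal_add_omega 1 α.2 hβ

theorem Omega1.exists_gt (α : Omega1) : ∃ β : Omega1, α < β :=
  ⟨⟨α.1 + 1, α.add_lt (Ordinal.one_lt_omega0.trans Ordinal.omega0_lt_omega_one)⟩,
    lt_add_one α.1⟩

theorem Omega1.add_nat_lt {δ : Omega1} (hδ : Order.IsSuccLimit δ) {α : Ordinal.{0}} (hα : α < δ.1)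
    (n : ℕ) : α + n < δ.1 := by
  induction n with
  | zero => simpa using hα
  | succ n ih =>
    by_contra! h
    refine hδ.2 (⟨α + n, ih.trans δ.2⟩ : Omega1) ⟨ih, fun γ h1 h2 => ?_⟩
    have h3 : (γ : Ordinal.{0}) < α + n + 1 := by
      have h2' : γ.1 < δ.1 := h2
      simpa [add_assoc] using h2'.trans_le h
    exact absurd (Order.lt_add_one_iff.1 h3) (not_le.2 h1)

theorem Omega1.countable_Iio (δ : Omega1) : (Set.Iio δ).Countable := by
  have h : (Set.Iio (δ : Ordinal.{0})).Countable := by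
    rw [← Cardinal.le_aleph0_iff_set_countable, Cardinal.mk_Iio_ordinal,
      Cardinal.lift_le_aleph0]
    have h1 : (δ : Ordinal.{0}).card < Cardinal.aleph 1 := by
      rw [← Cardinal.lt_ord, Cardinal.ord_aleph]
      exact δ.2
    rw [← Cardinal.succ_aleph0, Order.lt_succ_iff] at h1
    simpa using h1
  exact (h.preimage Subtype.val_injective).mono fun _ h => h

theorem Omega1.bddAbove_of_countable {A : Set Omega1} (hA : A.Countable) :
    ∃ β : Omega1, ∀ α ∈ A, α ≤ β := by
  have : Countable A := hA
  refine ⟨⟨⨆ x : A, x.1.1, Ordinal.iSup_lt_omega_one fun x => x.1.2⟩, fun α hα => ?_⟩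
  have := hA.to_subtype
  exact Ordinal.le_iSup (fun x : A => x.1.1) ⟨α, hα⟩

theorem isClub_limits : IsClub {δ : Omega1 | Order.IsSuccLimit δ} := by
  refine ⟨?_, fun α => ?_⟩
  · intro d hd hne _ δ hδ
    by_cases hmem : δ ∈ d
    · exact hd hmem
    obtain ⟨γ, hγ⟩ := hne
    have hlt : γ < δ := lt_of_le_of_ne (hδ.1 hγ) fun h => hmem (h ▸ hγ)
    refine ⟨fun h => h.not_lt hlt, fun β hβ => ?_⟩
    obtain ⟨ζ, hζ, hβζ⟩ := (lt_isLUB_iff hδ).1 hβ.1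
    exact hβ.2 hβζ (lt_of_le_of_ne (hδ.1 hζ) fun h => hmem (h ▸ hζ))
  · have hω := α.add_lt Ordinal.omega0_lt_omega_one
    refine ⟨⟨α.1 + ω, hω⟩, ?_, le_self_add (a := α.1)⟩
    have h := Ordinal.isSuccLimit_add α.1 Ordinal.isSuccLimit_omega0
    refine ⟨fun hmin => hmin.not_lt (b := α) ?_, fun β hβ => h.2 β.1 ⟨hβ.1, fun c h1 h2 => ?_⟩⟩
    · exact lt_add_of_pos_right α.1 Ordinal.omega0_pos
    · exact hβ.2 (c := ⟨c, h2.trans hω⟩) h1 h2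

theorem isClub_inter_limits {D : Set Omega1} (hD : IsClub D) :
    IsClub (D ∩ {δ | Order.IsSuccLimit δ}) := by
  refine hD.inter ?_ isClub_limits
  rw [Ordinal.cof_Iio, ← Ordinal.lift_cof, Cardinal.cof_omega_one]
  simpa using Cardinal.aleph0_lt_aleph_one.ne'

/-- An injection of `ω₁ × ω` into `ω₁` under which all limit ordinals are closed. -/
theorem exists_code : ∃ c : Omega1 → ℕ → Omega1,
    (∀ α β m n, c α m = c β n → α = β ∧ m = n) ∧
    ∀ δ, Order.IsSuccLimit δ → ∀ α < δ, ∀ m, c α m < δ := by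
  have hdig : ∀ α : Omega1, ∃ n : ℕ, (α : Ordinal.{0}) % ω = n := fun α =>
    Ordinal.lt_omega0.1 (Ordinal.mod_lt _ Ordinal.omega0_ne_zero)
  choose dig hdig using hdig
  have hlt : ∀ (α : Omega1) (n : ℕ), ω * ((α : Ordinal.{0}) / ω) + n < ω₁ := by
    intro α n
    refine Ordinal.isPrincipal_add_omega 1 ((Ordinal.mul_div_le _ _).trans_lt α.2) ?_
    exact (Ordinal.natCast_lt_omega0 n).trans Ordinal.omega0_lt_omega_one
  refine ⟨fun α m => ⟨_, hlt α (Nat.pair (dig α) m)⟩, fun α β m n h => ?_, fun δ hδ α hα m => ?_⟩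
  · have h' : ω * ((α : Ordinal.{0}) / ω) + (Nat.pair (dig α) m : ℕ) =
        ω * ((β : Ordinal.{0}) / ω) + (Nat.pair (dig β) n : ℕ) := congrArg Subtype.val h
    have h1 := congrArg (· / (ω : Ordinal.{0})) h'
    have h2 := congrArg (· % (ω : Ordinal.{0})) h'
    simp only [Ordinal.mul_add_div _ Ordinal.omega0_ne_zero,
      Ordinal.div_eq_zero_of_lt (Ordinal.natCast_lt_omega0 _), add_zero] at h1
    simp only [Ordinal.mul_add_mod_self, Ordinal.natCast_mod_omega0, Nat.cast_inj] at h2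
    obtain ⟨h3, h4⟩ := Nat.pair_eq_pair.1 h2
    refine ⟨Subtype.ext ?_, h4⟩
    rw [← Ordinal.div_add_mod α.1 ω, ← Ordinal.div_add_mod β.1 ω, h1, hdig, hdig, h3]
  · exact Omega1.add_nat_lt hδ (lt_of_le_of_lt (Ordinal.mul_div_le _ _) hα) _

/-- The graph of f is coded as a subset of ω₁. Limits are closed under the coding, so at a limit δ
the trace of the code on δ determines f below δ; hence D is thinned to limits, and its guesses
likewise. -/
theorem DiamondPlus.exists_guesses (h : DiamondPlus) :
    ∃ (w : Omega1 → ℕ → Omega1 → ℕ → ℕ) (V : Omega1 → ℕ → Set Omega1),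
    ∀ f : Omega1 → ℕ → ℕ, ∃ D : Set Omega1, IsClub D ∧ (∀ δ ∈ D, Order.IsSuccLimit δ) ∧
      ∀ δ ∈ D, (∃ i, ∀ α < δ, w δ i α = f α) ∧ ∃ j, ∀ α < δ, α ∈ V δ j ↔ α ∈ D := by
  obtain ⟨W, hW, hguess⟩ := h
  obtain ⟨c, hc, hcδ⟩ := exists_code
  have henum := fun δ => Set.countable_iff_exists_subset_range.1 (hW δ)
  choose u hu using henum
  -- For a correct guess this set is the singleton `{f α n}`; otherwise the infimum is irrelevant.
  refine ⟨fun δ i α n => sInf {k | c α (Nat.pair n k) ∈ u δ i},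
    fun δ j => u δ j ∩ {δ | Order.IsSuccLimit δ}, fun f => ?_⟩
  obtain ⟨D, hD, hDW⟩ := hguess {β | ∃ α n, β = c α (Nat.pair n (f α n))}
  refine ⟨D ∩ {δ | Order.IsSuccLimit δ}, isClub_inter_limits hD, fun δ hδ => hδ.2, ?_⟩
  rintro δ ⟨hδD, hδ⟩
  obtain ⟨h1, h2⟩ := hDW δ hδD
  obtain ⟨i, hi⟩ := hu δ h1
  obtain ⟨j, hj⟩ := hu δ h2
  refine ⟨⟨i, fun α hα => funext fun n => ?_⟩, j, fun α hα => ?_⟩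
  · have : {k | c α (Nat.pair n k) ∈ u δ i} = {f α n} := by
      ext k
      simp only [hi, Set.mem_inter_iff, Set.mem_ofPred_eq, Set.mem_Iio, hcδ δ hδ α hα, and_true,
        Set.mem_singleton_iff]
      constructor
      · rintro ⟨α', n', h⟩
        obtain ⟨rfl, h⟩ := hc _ _ _ _ h
        obtain ⟨rfl, h⟩ := Nat.pair_eq_pair.1 h
        exact h
      · rintro rfl
        exact ⟨α, n, rfl⟩
    simp [this]
  · have hα' : α < δ := hα
    simp [hj, hα']

theorem IsClub.mem_of_forall_lt {D : Set Omega1} (hD : IsClub D) {δ : Omega1}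
    (h : ∀ γ < δ, ∃ d ∈ D, γ < d ∧ d ≤ δ) (hδ : ∃ γ, γ < δ) : δ ∈ D := by
  refine hD.isLUB_mem (t := {d | d ∈ D ∧ d ≤ δ}) (fun _ h => h.1) ?_ ⟨fun d hd => hd.2, ?_⟩
  · obtain ⟨γ, hγ⟩ := hδ
    obtain ⟨d, hd, -, hdδ⟩ := h γ hγ
    exact ⟨d, hd, hdδ⟩
  · intro b hb
    by_contra! hlt
    obtain ⟨d, hd, hbd, hdδ⟩ := h b hlt
    exact absurd (hb ⟨hd, hdδ⟩) (not_le.2 hbd)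

theorem IsClub.exists_gt {D : Set Omega1} (hD : IsClub D) (γ : Omega1) : ∃ d ∈ D, γ < d := by
  obtain ⟨β, hβ⟩ := γ.exists_gt
  obtain ⟨d, hd, hβd⟩ := hD.isCofinal β
  exact ⟨d, hd, hβ.trans_le hβd⟩

/-- The ladder at `α`, empty if `α` is not a limit. -/
def LadderSystem.set (C : LadderSystem) (α : Omega1) : Set Omega1 :=
  {ξ | ∃ h : Order.IsSuccLimit α, ξ ∈ C.ladder ⟨α, h⟩}

theorem LadderSystem.exists_seq (C : LadderSystem) (α : Omega1) (hα : Order.IsSuccLimit α) :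
    ∃ x : ℕ → Omega1, StrictMono x ∧ Set.range x = C.set α ∧ ∀ γ < α, ∃ n, γ ≤ x n := by
  obtain ⟨o⟩ := C.type_omega ⟨α, hα⟩
  refine ⟨fun n => (o n).1, fun m n h => o.strictMono h, ?_, fun γ hγ => ?_⟩
  · ext ξ
    constructor
    · rintro ⟨n, rfl⟩
      exact ⟨hα, (o n).2⟩
    · rintro ⟨_, h⟩
      exact ⟨o.symm ⟨ξ, h⟩, by simp⟩
  · obtain ⟨ξ, hξ, hle⟩ := C.cofinal ⟨α, hα⟩ γ hγ
    exact ⟨o.symm ⟨ξ, hξ⟩, by simpa using hle⟩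

end Omega1

/-! ### The Aronszajn tree of branches and its (non-)uniformizations -/

section BranchTree

variable (E : Omega1 → ℕ → Omega1 → ℕ)

/-- The tree whose nodes of height `ξ` are the functions on `[0, ξ]` which are branches of `E`
below `ξ`, represented by functions vanishing above `ξ`. -/
def BranchTree : Type :=
  Shrink.{0} {p : Omega1 × (Omega1 → ℕ) | Branch E p.1 p.2 ∧ ∀ η, p.1 < η → p.2 η = 0}

namespace BranchTree

variable {E}

/-- The height of a node as an element of `ω₁`. -/
noncomputable def ht (t : BranchTree E) : Omega1 := ((equivShrink _).symm t).1.1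

/-- The function representing a node. -/
noncomputable def fn (t : BranchTree E) : Omega1 → ℕ := ((equivShrink _).symm t).1.2

theorem branch (t : BranchTree E) : Branch E t.ht t.fn := ((equivShrink _).symm t).2.1

theorem fn_eq_zero (t : BranchTree E) {η : Omega1} (h : t.ht < η) : t.fn η = 0 :=
  ((equivShrink _).symm t).2.2 η h

theorem eq_of_eqOn {s t : BranchTree E} (h : s.ht = t.ht)
    (hfn : Set.EqOn s.fn t.fn (Set.Iic s.ht)) : s = t := by
  refine (equivShrink _).symm.injective (Subtype.ext (Prod.ext h (funext fun η => ?_)))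
  rcases le_or_gt η s.ht with hη | hη
  · exact hfn hη
  · exact (s.fn_eq_zero hη).trans (t.fn_eq_zero (h ▸ hη)).symm

theorem exists_node {ξ : Omega1} {f : Omega1 → ℕ} (hf : Branch E ξ f) :
    ∃ t : BranchTree E, t.ht = ξ ∧ Set.EqOn t.fn f (Set.Iic ξ) := by
  classical
  have h : (ξ, fun η => if η ≤ ξ then f η else 0) ∈
      {p : Omega1 × (Omega1 → ℕ) | Branch E p.1 p.2 ∧ ∀ η, p.1 < η → p.2 η = 0} := by
    refine ⟨hf.congr fun η hη => ?_, fun η hη => if_neg (not_le.2 hη)⟩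
    exact (if_pos (le_of_lt hη)).symm
  refine ⟨equivShrink _ ⟨_, h⟩, ?_, fun η hη => ?_⟩
  · simp [ht]
  · simpa [fn] using fun hlt => absurd hlt (not_lt.2 hη)

noncomputable instance : PartialOrder (BranchTree E) where
  le s t := s.ht ≤ t.ht ∧ Set.EqOn s.fn t.fn (Set.Iic s.ht)
  le_refl s := ⟨le_rfl, fun _ _ => rfl⟩
  le_trans _ _ _ h1 h2 :=
    ⟨h1.1.trans h2.1, fun η hη => (h1.2 hη).trans (h2.2 (le_trans hη h1.1))⟩
  le_antisymm _ _ h1 h2 := eq_of_eqOn (le_antisymm h1.1 h2.1) h1.2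

theorem ht_strictMono : StrictMono (ht : BranchTree E → Omega1) := fun _ _ h =>
  lt_of_le_of_ne h.le.1 fun heq => h.ne (eq_of_eqOn heq h.le.2)

theorem le_of_ht_le {r s t : BranchTree E} (hr : r ≤ t) (hs : s ≤ t) (h : r.ht ≤ s.ht) : r ≤ s :=
  ⟨h, fun _ hη => (hr.2 hη).trans (hs.2 (le_trans hη h)).symm⟩

theorem exists_lt {t : BranchTree E} {ξ : Omega1} (h : ξ < t.ht) : ∃ s < t, s.ht = ξ := by
  obtain ⟨s, hs, hst⟩ := exists_node (t.branch.mono h.le)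
  refine ⟨s, lt_of_le_of_ne ⟨hs.trans_le h.le, hs ▸ hst⟩ ?_, hs⟩
  rintro rfl
  exact h.ne' hs

instance : IsSetTree (BranchTree E) where
  wellOrder_below t := by
    have : ∀ r s : Set.Iio t, r.1.ht < s.1.ht ↔ r < s := by
      refine fun r s => ⟨fun h => ?_, fun h => ht_strictMono h⟩
      refine lt_of_le_of_ne (le_of_ht_le r.2.le s.2.le h.le) fun heq => ?_
      exact h.ne (congrArg (fun x : Set.Iio t => x.1.ht) heq)
    let f : (· < · : Set.Iio t → Set.Iio t → Prop) ↪r (· < · : Omega1 → Omega1 → Prop) :=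
      { toFun := fun s => s.1.ht
        inj' := fun r s h => le_antisymm (le_of_ht_le r.2.le s.2.le (le_of_eq h))
          (le_of_ht_le s.2.le r.2.le (ge_of_eq h))
        map_rel_iff' := this _ _ }
    exact f.isWellOrder

theorem height_eq (t : BranchTree E) : height t = (t.ht : Ordinal.{0}) := by
  suffices h : ∀ (ξ : Omega1) (t : BranchTree E), t.ht = ξ → height t = (ξ : Ordinal.{0}) from
    h _ t rfl
  intro ξ
  induction ξ using WellFoundedLT.induction with
  | ind ξ ih =>
  rintro t rfl
  have key : ∀ ζ, ζ < height t ↔ ζ < (t.ht : Ordinal.{0}) := by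
    intro ζ
    constructor
    · intro h
      obtain ⟨s, ⟨hst, hs⟩, -⟩ := existsUnique_below h
      have h1 := ht_strictMono hst
      rw [← hs, ih _ h1 s rfl]
      exact h1
    · intro h
      obtain ⟨s, hst, hs⟩ := exists_lt (t := t) (ξ := ⟨ζ, h.trans t.ht.2⟩) h
      have h1 := ih _ (ht_strictMono hst) s rfl
      rw [hs] at h1
      have h2 := height_eq_typein (t := t) ⟨s, hst⟩
      rw [← show height s = ζ from h1, h2]
      exact Ordinal.typein_lt_type _ _
  exact le_antisymm (le_of_forall_lt fun ζ h => (key ζ).1 h)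
    (le_of_forall_lt fun ζ h => (key ζ).2 h)

theorem isAronszajn (hne : ∀ ξ, ∃ b, Branch E ξ b) : IsAronszajn (BranchTree E) := by
  have hlevel : ∀ ξ : Omega1, {t : BranchTree E | t.ht = ξ}.Countable := by
    intro ξ
    have hn : ∀ t : BranchTree E, ∃ n, Set.EqOn t.fn (E t.ht n) (Set.Iio t.ht) := fun t =>
      t.branch.1 _ le_rfl
    choose n hn using hn
    refine (Set.mapsTo_univ (fun t => (n t, t.fn ξ)) _).countable_of_injOn ?_
      (Set.countable_univ (α := ℕ × ℕ))
    rintro s rfl t hts h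
    have hts : t.ht = s.ht := hts
    obtain ⟨h1, h2⟩ := Prod.ext_iff.1 h
    refine eq_of_eqOn hts.symm fun η hη => ?_
    rcases (Set.mem_Iic.1 hη).eq_or_lt with rfl | hη
    · exact h2
    · have h1 : n s = n t := h1
      rw [hn s hη, h1, hn t (hts ▸ hη), hts]
  refine ⟨⟨?_, fun α hα => ?_⟩, fun α => ?_, fun A hA => ?_⟩
  · refine Set.eq_empty_iff_forall_notMem.2 fun t ht => ?_
    have h1 : height t = ω₁ := ht
    rw [height_eq] at h1
    exact absurd h1 (ne_of_lt t.ht.2)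
  · by_contra! hlt
    obtain ⟨b, hb⟩ := hne ⟨α, hlt⟩
    obtain ⟨t, ht, -⟩ := exists_node hb
    have : t ∈ level (BranchTree E) α := by
      change height t = α
      rw [height_eq, ht]
    have hα' : level (BranchTree E) α = ∅ := hα
    exact absurd this (hα' ▸ Set.notMem_empty t)
  · by_cases hα : α < ω₁
    · refine (hlevel ⟨α, hα⟩).mono fun t ht => Subtype.ext ?_
      have h1 : height t = α := ht
      rwa [height_eq] at h1
    · refine Set.countable_empty.mono fun t ht => hα ?_
      have h1 : height t = α := ht
      rw [height_eq] at h1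
      exact h1 ▸ t.ht.2
  · by_contra hunc
    have hinj : Set.InjOn (ht : BranchTree E → Omega1) A := by
      intro s hs t ht h
      rcases hA.total hs ht with hle | hle
      · exact eq_of_eqOn h hle.2
      · exact (eq_of_eqOn h.symm hle.2).symm
    have hunb : ∀ ξ : Omega1, ∃ t ∈ A, ξ < t.ht := by
      intro ξ
      by_contra! h
      refine hunc (Set.MapsTo.countable_of_injOn (t := Set.Iic ξ) (fun t ht => h t ht) hinj ?_)
      obtain ⟨ζ, hζ⟩ := ξ.exists_gt
      exact ζ.countable_Iio.mono fun η hη => lt_of_le_of_lt hη hζ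
    choose t htA ht using hunb
    have hcoh : ∀ ξ s, s ∈ A → ξ < s.ht → s.fn ξ = (t ξ).fn ξ := by
      intro ξ s hs hξ
      rcases hA.total hs (htA ξ) with hle | hle
      · exact hle.2 hξ.le
      · exact (hle.2 (ht ξ).le).symm
    -- An infinite fibre of the glued function contains countably many points, all below one chain
    -- node, which would then repeat v infinitely often.
    have hcount : ∀ v, {ξ | (t ξ).fn ξ = v}.Countable := by
      intro v
      by_contra hv
      have hinf : {ξ | (t ξ).fn ξ = v}.Infinite := fun hfin => hv hfin.countable
      obtain ⟨x, hx⟩ := hinf.natEmbedding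
      obtain ⟨β, hβ⟩ := Omega1.bddAbove_of_countable (Set.countable_range fun n => (x n).1)
      refine Set.infinite_of_injective_forall_mem (f := fun n => (x n).1)
        (fun m n h => hx (Subtype.ext h)) (fun n => ?_) ((t β).branch.2 v)
      have h1 := (hβ _ ⟨n, rfl⟩).trans_lt (ht β)
      exact ⟨h1, (hcoh _ _ (htA β) h1).trans (x n).2⟩
    obtain ⟨β, hβ⟩ := Omega1.bddAbove_of_countable
      ((Set.countable_iUnion hcount).mono fun ξ _ => Set.mem_iUnion.2 ⟨(t ξ).fn ξ, rfl⟩)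
      (A := Set.univ)
    obtain ⟨ζ, hζ⟩ := β.exists_gt
    exact absurd (hβ ζ trivial) (not_le.2 hζ)

theorem ht_restrict {S : Set (BranchTree E)} (hS : IsSubtree S) (s : S) (ξ : Omega1)
    (h : (ξ : Ordinal.{0}) < height s.1) : (hS.restrict s ξ h).1.ht = ξ := by
  have h1 := height_restrict s.1 (ξ : Ordinal.{0}) h
  rw [height_eq] at h1
  exact Subtype.ext h1

theorem fn_restrict {S : Set (BranchTree E)} (hS : IsSubtree S) (s : S) (ξ : Omega1)
    (h : (ξ : Ordinal.{0}) < height s.1) :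
    Set.EqOn (hS.restrict s ξ h).1.fn s.1.fn (Set.Iic ξ) := by
  have h1 := (restrict_lt s.1 (ξ : Ordinal.{0}) h).le.2
  have h2 : (restrict s.1 (ξ : Ordinal.{0}) h).ht = ξ := ht_restrict hS s ξ h
  rw [h2] at h1
  exact h1

theorem exists_mem_ht_eq {S : Set (BranchTree E)} (hS : IsSubtree S) (ξ : Omega1) :
    ∃ s : S, s.1.ht = ξ := by
  obtain ⟨s₀, hs₀⟩ := hS.nonempty
  obtain ⟨t, htS, -, ht⟩ := hS.pruned s₀ hs₀ ξ ξ.2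
  rw [height_eq] at ht
  rcases (show ξ ≤ t.ht from ht).eq_or_lt with h | h
  · exact ⟨⟨t, htS⟩, h.symm⟩
  · obtain ⟨s, hst, hs⟩ := exists_lt h
    exact ⟨⟨s, hS.lower hst.le htS⟩, hs⟩

/-- The subtree is the set of nodes satisfying `P` below their height, and `hext` with the node's
own last value as v shows that it is pruned. -/
theorem hasUniformization {C : LadderSystem} (f : C.Colouring ℕ) {g : Omega1 → ℕ}
    (hfg : ∀ α ξ, f α ξ = g α.1) (P : Omega1 → (Omega1 → ℕ) → Prop)
    (hmono : ∀ γ δ b, γ ≤ δ → P δ b → P γ b)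
    (hcongr : ∀ γ b b', P γ b → Set.EqOn b b' (Set.Iio γ) → P γ b')
    (col : Omega1 → (Omega1 → ℕ) → ℕ)
    (hcol : ∀ ξ b b', Set.EqOn b b' (Set.Iic ξ) → col ξ b = col ξ b')
    (hroot : ∃ ξ b, Branch E ξ b ∧ P ξ b)
    (hext : ∀ β, ∀ α < β, ∀ b, Branch E α b → P α b → ∀ v N,
      ∃ c, Branch E β c ∧ P β c ∧ Continues α b v N β c)
    (hP : ∀ α b, Order.IsSuccLimit α → Branch E α b → P α b →
      {ξ | ξ ∈ C.set α ∧ col ξ b ≠ g α}.Finite) : HasUniformization (BranchTree E) f := by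
  have hS : IsSubtree {t : BranchTree E | P t.ht t.fn} := by
    refine ⟨?_, fun t s hst ht => ?_, fun s hs α hα => ?_⟩
    · obtain ⟨ξ, b, hb, hPb⟩ := hroot
      obtain ⟨t, ht, htb⟩ := exists_node hb
      refine ⟨t, ?_⟩
      change P t.ht t.fn
      rw [ht]
      exact hcongr _ _ _ hPb fun η hη => (htb (Set.Iio_subset_Iic_self hη)).symm
    · exact hcongr _ _ _ (hmono _ _ _ hst.1 ht) fun η hη => (hst.2 (Set.Iio_subset_Iic_self hη)).symm
    · rcases le_or_gt α (s.ht : Ordinal.{0}) with h | h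
      · exact ⟨s, hs, le_rfl, h.trans (height_eq s).ge⟩
      · obtain ⟨c, hc, hPc, hcs⟩ := hext ⟨α, hα⟩ s.ht h s.fn s.branch hs (s.fn s.ht) 0
        obtain ⟨t, ht, htc⟩ := exists_node hc
        refine ⟨t, ?_, ⟨ht ▸ le_of_lt h, fun η hη => ?_⟩, ?_⟩
        · change P t.ht t.fn
          rw [ht]
          exact hcongr _ _ _ hPc fun η hη => (htc (Set.Iio_subset_Iic_self hη)).symm
        · rw [htc (lt_of_le_of_lt hη h).le]
          rcases (Set.mem_Iic.1 hη).eq_or_lt with rfl | hη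
          · exact hcs.2.1.symm
          · exact (hcs.1 hη).symm
        · rw [height_eq, ht]
  refine ⟨_, hS, fun s => col s.1.ht s.1.fn, fun s α hs => ?_⟩
  rw [height_eq] at hs
  have hs' : s.1.ht = α.1 := Subtype.ext hs
  have hfin := hP α.1 s.1.fn α.2 (hs' ▸ s.1.branch) (hs' ▸ s.2)
  refine Set.Finite.of_finite_image (f := Subtype.val) (hfin.subset ?_)
    Subtype.val_injective.injOn
  rintro _ ⟨ξ, hξ, rfl⟩
  refine ⟨⟨α.2, ξ.2⟩, fun h => hξ ?_⟩
  have h1 := hcol ξ.1 _ _ (fn_restrict hS s ξ.1 (by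
    rw [height_eq, hs]
    exact C.lt_of_mem α ξ.1 ξ.2))
  simp only [ht_restrict]
  rw [h1, h, hfg]

/-- A node of height ξ is determined by two numbers, an index in `E ξ` and its last value, so a
uniformization is coded by a function that is guessed at some δ. The colouring at δ splits the
ladder into infinitely many infinite classes, one for each pair (guess, branch), and disagrees with
that pair on the whole class. -/
theorem not_unif (C : LadderSystem) (w : Omega1 → ℕ → Omega1 → ℕ → ℕ)
    (hw : ∀ f : Omega1 → ℕ → ℕ, ∃ δ, Order.IsSuccLimit δ ∧ ∃ i, ∀ α < δ, w δ i α = f α) :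
    ¬ Unif (BranchTree E) (Fin 2) C := by
  classical
  obtain ⟨idx, hidx⟩ : ∃ idx : Omega1 → (Omega1 → ℕ) → ℕ, ∀ ξ b,
      (∃ n, Set.EqOn b (E ξ n) (Set.Iio ξ)) → Set.EqOn b (E ξ (idx ξ b)) (Set.Iio ξ) := by
    refine ⟨fun ξ b => sInf {n | Set.EqOn b (E ξ n) (Set.Iio ξ)}, fun ξ b h => ?_⟩
    exact Nat.sInf_mem (s := {n | Set.EqOn b (E ξ n) (Set.Iio ξ)}) h
  have ho : ∀ α, ∃ o : ℕ ≃o C.ladder α, True := fun α => (C.type_omega α).elim fun o => ⟨o, trivial⟩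
  choose o _ using ho
  -- With m coding (i, n), this is the colour that the i-th guess at δ gives to the node of height ξ
  -- on the n-th branch.
  let val : Omega1 → ℕ → Omega1 → ℕ := fun δ m ξ =>
    w δ (Nat.unpair m).1 ξ
      (Nat.pair (idx ξ (E δ (Nat.unpair m).2)) (E δ (Nat.unpair m).2 ξ))
  let f : C.Colouring (Fin 2) := fun α ξ =>
    if val α.1 (Nat.unpair ((o α).symm ξ)).1 ξ.1 = 0 then 1 else 0
  intro hunif
  obtain ⟨S, hS, φ, hφ⟩ := hunif f
  let F : Omega1 → ℕ → ℕ := fun ξ m =>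
    if h : ∃ s : S, s.1.ht = ξ ∧ Set.EqOn s.1.fn (E ξ (Nat.unpair m).1) (Set.Iio ξ) ∧
      s.1.fn ξ = (Nat.unpair m).2 then φ h.choose else 0
  have hF : ∀ (s : S) (n : ℕ), Set.EqOn s.1.fn (E s.1.ht n) (Set.Iio s.1.ht) →
      F s.1.ht (Nat.pair n (s.1.fn s.1.ht)) = φ s := by
    intro s n hn
    have h : ∃ r : S, r.1.ht = s.1.ht ∧
        Set.EqOn r.1.fn (E s.1.ht (Nat.unpair (Nat.pair n (s.1.fn s.1.ht))).1)
          (Set.Iio s.1.ht) ∧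
        r.1.fn s.1.ht = (Nat.unpair (Nat.pair n (s.1.fn s.1.ht))).2 :=
      ⟨s, rfl, by simpa using hn, by simp⟩
    have hall : ∀ r : S, (r.1.ht = s.1.ht ∧
        Set.EqOn r.1.fn (E s.1.ht (Nat.unpair (Nat.pair n (s.1.fn s.1.ht))).1)
          (Set.Iio s.1.ht) ∧
        r.1.fn s.1.ht = (Nat.unpair (Nat.pair n (s.1.fn s.1.ht))).2) → φ r = φ s := by
      rintro r ⟨h1, h2, h3⟩
      rw [Nat.unpair_pair] at h2 h3
      refine congrArg φ (Subtype.ext (eq_of_eqOn h1 fun η hη => ?_))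
      rw [h1] at hη
      rcases (Set.mem_Iic.1 hη).eq_or_lt with rfl | hη
      · exact h3
      · exact (h2 hη).trans (hn hη).symm
    simp only [F, dif_pos h]
    exact congrArg Fin.val (hall _ h.choose_spec)
  obtain ⟨δ, hδ, i, hi⟩ := hw F
  obtain ⟨s, hs⟩ := exists_mem_ht_eq hS δ
  obtain ⟨n, hn⟩ := s.1.branch.1 δ hs.ge
  have hhs : height s.1 = ((⟨δ, hδ⟩ : LimOmega1).1 : Ordinal.{0}) := by rw [height_eq, hs]
  refine Set.infinite_of_injective_forall_mem
    (f := fun k : ℕ => o ⟨δ, hδ⟩ (Nat.pair (Nat.pair i n) k)) (fun k l h => ?_) (fun k => ?_)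
    (hφ s ⟨δ, hδ⟩ hhs)
  · exact (Nat.pair_eq_pair.1 ((o ⟨δ, hδ⟩).injective h)).2
  · set ξ := o ⟨δ, hδ⟩ (Nat.pair (Nat.pair i n) k) with hξ
    have hξδ : ξ.1 < δ := C.lt_of_mem ⟨δ, hδ⟩ ξ.1 ξ.2
    have hlt : (ξ.1 : Ordinal.{0}) < height s.1 := by rw [hhs]; exact hξδ
    have hval : val δ (Nat.pair i n) ξ.1 = φ (hS.restrict s ξ.1 hlt) := by
      have h1 := ht_restrict hS s ξ.1 hlt
      have h2 := fn_restrict hS s ξ.1 hlt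
      have h3 := hidx ξ.1 (E δ n) (by
        obtain ⟨m, hm⟩ := s.1.branch.1 ξ.1 (hs ▸ hξδ.le)
        exact ⟨m, fun η hη => (hn (lt_trans hη hξδ)).symm.trans (hm hη)⟩)
      have h4 := hF (hS.restrict s ξ.1 hlt) (idx ξ.1 (E δ n)) (by
        rw [h1]
        exact fun η hη => ((h2 (Set.Iio_subset_Iic_self hη)).trans (hn (lt_trans hη hξδ))).trans (h3 hη))
      rw [h1, h2 (Set.mem_Iic.2 le_rfl), hn hξδ] at h4
      simp only [val, Nat.unpair_pair]
      rw [hi ξ.1 hξδ]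
      exact h4
    have hf : f ⟨δ, hδ⟩ ξ = if val δ (Nat.pair i n) ξ.1 = 0 then 1 else 0 := by
      simp [f, hξ]
    change φ (hS.restrict s ξ.1 hlt) ≠ f ⟨δ, hδ⟩ ξ
    rw [hf, hval]
    generalize φ (hS.restrict s ξ.1 hlt) = z
    fin_cases z <;> simp

end BranchTree

end BranchTree

end TreeUnif

/-! ### Assembling the theorem -/

open TreeUnif in
theorem corollary6p3 (hD : TreeUnif.DiamondPlus) (C : TreeUnif.LadderSystem) :
    ∃ (T : Type) (_ : PartialOrder T) (_ : TreeUnif.IsSetTree T),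
      TreeUnif.IsAronszajn T ∧ TreeUnif.UnifConst T ℕ C ∧ ¬ TreeUnif.Unif T (Fin 2) C := by
  classical
  obtain ⟨w, V, hwV⟩ := hD.exists_guesses
  have he : ∀ ν : Omega1, ∃ e : Omega1 → ℕ, Set.InjOn e (Set.Iio ν) := fun ν =>
    Set.countable_iff_exists_injOn.1 ν.countable_Iio
  choose e he using he
  have ha : ∀ δ : Omega1, ∃ a : ℕ → Omega1, ∀ α < δ, ∃ i, a i = α := fun δ => by
    have : Nonempty Omega1 := ⟨δ⟩
    obtain ⟨a, ha⟩ := Set.countable_iff_exists_subset_range.1 δ.countable_Iio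
    exact ⟨a, fun α hα => ha hα⟩
  choose a ha using ha
  -- Index 0 imposes nothing. The other indices run through a guess of g below δ, a guess of D below
  -- δ, and a value at δ; δ itself is put into the guessed club, since such a guess serves only when
  -- δ ∈ D.
  let G : Omega1 → ℕ → (Omega1 → ℕ) × Set Omega1 := fun δ q =>
    Nat.casesOn q (fun _ => 0, ∅) fun q =>
      (Function.update (fun α => w δ (Nat.unpair q).1 α 0) δ (Nat.unpair (Nat.unpair q).2).2,
        {γ | γ < δ ∧ γ ∈ V δ (Nat.unpair (Nat.unpair q).2).1} ∪ {δ})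
  have hL : ∀ γ, ∀ ξ ∈ C.set γ, ξ < γ := fun γ ξ ⟨h, hξ⟩ => C.lt_of_mem ⟨γ, h⟩ ξ hξ
  obtain ⟨E, hE⟩ := exists_levels C.set e a G hL
  have hG : ∀ δ, ∃ q, (G δ q).2 = ∅ := fun δ => ⟨0, rfl⟩
  have hext := exists_continuation hL C.exists_seq ha hE hG
  have hzero : ∀ b, Branch E ⟨0, Ordinal.omega_pos 1⟩ b := by
    have hmin : ∀ η : Omega1, ¬ η < ⟨0, Ordinal.omega_pos 1⟩ := fun η => not_lt_zero (a := η.1)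
    refine fun b => ⟨fun γ hγ => ⟨0, fun η hη => absurd (lt_of_lt_of_le hη hγ) (hmin η)⟩,
      fun v => Set.finite_empty.subset fun η hη => hmin η hη.1⟩
  refine ⟨BranchTree E, inferInstance, inferInstance, BranchTree.isAronszajn fun ξ => ?_,
    fun f hf => ?_, BranchTree.not_unif C w fun F => ?_⟩
  · obtain ⟨β, hβ⟩ := ξ.exists_gt
    obtain ⟨c, hc, -⟩ := hext β _ (lt_of_le_of_lt (zero_le (a := ξ.1)) hβ) 0 (hzero _) 0 0
    exact ⟨c, hc.mono hβ.le⟩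
  · choose k hk using hf
    let g : Omega1 → ℕ := fun α => if h : Order.IsSuccLimit α then k ⟨α, h⟩ else 0
    obtain ⟨D, hD, hDlim, hDG⟩ := hwV fun α _ => g α
    have hDG' : ∀ δ ∈ D, ∃ q, ∀ γ ≤ δ, (G δ q).1 γ = g γ ∧ (γ ∈ (G δ q).2 ↔ γ ∈ D) := by
      intro δ hδ
      obtain ⟨⟨i, hi⟩, j, hj⟩ := hDG δ hδ
      refine ⟨Nat.pair i (Nat.pair j (g δ)) + 1, fun γ hγ => ?_⟩
      simp only [G, Nat.unpair_pair]
      rcases hγ.eq_or_lt with rfl | hγ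
      · simp [hδ]
      · rw [Function.update_of_ne hγ.ne, hi γ hγ]
        simp [hγ, hγ.ne, hj γ hγ]
    refine BranchTree.hasUniformization f (g := g) (fun α ξ => ?_) (Good E C.set e D g)
      (fun _ _ _ h1 h2 => h2.mono h1) (fun _ _ _ h1 h2 => h1.congr hL (fun _ _ => rfl)
        (fun _ _ => Iff.rfl) (fun _ _ => rfl) h2)
      (fun ξ b => colour E C.set e g (next D ξ) ξ b)
      (fun _ _ _ h => colour_congr (fun _ _ => rfl) (fun _ _ => rfl) h)
      ⟨_, 0, hzero _, fun γ hγ hγD => ?_⟩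
      (exists_good_continuation hL he C.exists_seq ha hE hG hDlim
        (fun δ => hD.mem_of_forall_lt) hDG') (fun α b hα hb hg => ?_)
    · rw [hk]
      simp [g, α.2]
    · obtain ⟨η, hη⟩ := not_isMin_iff.1 (hDlim γ hγD).1
      exact absurd (lt_of_lt_of_le hη hγ) (not_lt_zero (a := η.1))
    · by_cases hαD : α ∈ D
      · exact hg α le_rfl hαD
      · exact finite_colour_ne hL he C.exists_seq (fun γ ξ h => h.1)
          (fun δ => hD.mem_of_forall_lt) hD.exists_gt hα hαD hb
  · obtain ⟨D, hD, hDlim, hDG⟩ := hwV F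
    obtain ⟨δ, hδ, -⟩ := hD.exists_gt ⟨0, Ordinal.omega_pos 1⟩
    exact ⟨δ, hDlim δ hδ, (hDG δ hδ).1⟩
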